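/- Let $T$ be the torus with one open disc removed, let $h\colon T\to T$ be a homeomorphism that fixes $\partial T$ pointwise, and let $M = T\times[0,1]/\big((p,1)\sim(h(p),0)\big)$ be the untwisted punctured torus bundle with monodromy $h$. Suppose that $M$ is hyperbolic, i.e. that $h$ is of (pseudo-)Anosov type: the map $h_+\in \mathrm{SL}(2,\mathbb{Z})$ induced by $h$ on $H_1(T;\mathbb{Z})\cong\mathbb{Z}^2$ satisfies $|\operatorname{tr} h_+|>2$. Take a base point $x\in\partial T\times\{0\}$, and let $G\le \pi_1(M,x)$ be the fundamental group of the fibre $T\times\{0\}$, so that $\pi_1(M)\cong G\rtimes_{h_*}\mathbb{Z}$. Put $G_2=[G,G]$ and $G_3=[G_2,G]$. Let $<$ be a bi-order of $\pi_1(M)$ (a strict total order invariant under left and right multiplication), and let $<_2$ be the bi-order that it induces on $G_2$. A subgroup $C$ of $G_2$ is convex if $a<_2 g<_2 b$ with $a,b\in C$ and $g\in G_2$ implies $g\in C$; it is a maximal convex subgroup if it is convex and proper and the only convex subgroups of $G_2$ that contain it are $C$ and $G_2$. If $C$ is a maximal convex subgroup of $G_2$ with respect to $<_2$, then $C=G_3$.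 -/

import Mathlib

/-! ### Bi-orders and convex subgroups -/

/-- A bi-order of a group: a strict total order of its elements that is invariant under left and
right multiplication. -/
structure IsBiOrder {Γ : Type*} [Group Γ] (lt : Γ → Γ → Prop) : Prop where
  irrefl : ∀ a, ¬ lt a a
  trans : ∀ a b c, lt a b → lt b c → lt a c
  total : ∀ a b, lt a b ∨ a = b ∨ lt b a
  mul_left : ∀ g a b, lt a b → lt (g * a) (g * b)
  mul_right : ∀ g a b, lt a b → lt (a * g) (b * g)

/-- The order that an order of `Γ` induces on a subgroup. -/
def inducedOrder {Γ : Type*} [Group Γ] (lt : Γ → Γ → Prop) (H : Subgroup Γ) : H → H → Prop :=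
  fun a b => lt (a : Γ) (b : Γ)

/-- A subgroup `C` is convex if `a < g < b` with `a, b ∈ C` implies `g ∈ C`. -/
def IsConvexSubgroup {Γ : Type*} [Group Γ] (lt : Γ → Γ → Prop) (C : Subgroup Γ) : Prop :=
  ∀ a ∈ C, ∀ b ∈ C, ∀ g : Γ, lt a g → lt g b → g ∈ C

/-- A convex subgroup is maximal if it is proper and the only convex subgroups that contain it are
itself and the whole group. -/
def IsMaximalConvexSubgroup {Γ : Type*} [Group Γ] (lt : Γ → Γ → Prop) (C : Subgroup Γ) : Prop :=
  IsConvexSubgroup lt C ∧ C ≠ ⊤ ∧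
    ∀ D : Subgroup Γ, IsConvexSubgroup lt D → C ≤ D → D = C ∨ D = ⊤

/-! ### Punctured torus bundles -/

/-- The torus with one boundary component: `(ℝ/ℤ)²` with the open disc
`{(s, t) | |s| < 1/4 and |t| < 1/4}` removed. The norm of `ℝ/ℤ` is the distance to `0`, and the
product carries the maximum norm. -/
abbrev PuncturedTorus : Type :=
  {p : UnitAddCircle × UnitAddCircle // 1 / 4 ≤ ‖p‖}

/-- The boundary circle of the punctured torus. -/
def PuncturedTorus.boundary : Set PuncturedTorus :=
  {p | ‖p.1‖ = 1 / 4}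

/-- The bundle over the circle with fibre the punctured torus and monodromy `h`: the quotient space
of `T × [0, 1]` by `(p, 1) ∼ (h p, 0)`. -/
abbrev PuncturedTorusBundle (h : PuncturedTorus ≃ₜ PuncturedTorus) : Type :=
  Quot fun a b : PuncturedTorus × unitInterval => a.2 = 1 ∧ b = (h a.1, 0)

/-- The inclusion of the punctured torus as the fibre at height `0`. -/
def fibreInclusion (h : PuncturedTorus ≃ₜ PuncturedTorus) :
    C(PuncturedTorus, PuncturedTorusBundle h) where
  toFun p := Quot.mk _ (p, 0)
  continuous_toFun := continuous_quot_mk.comp (by fun_prop)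

/-- The subgroup `G` of `π₁(M)` in `π₁(M) = G ⋊ ℤ`: the fundamental group of the fibre, viewed
inside `π₁(M)` through the inclusion. -/
noncomputable def fibreGroup (h : PuncturedTorus ≃ₜ PuncturedTorus) (x : PuncturedTorus) :
    Subgroup (FundamentalGroup (PuncturedTorusBundle h) (fibreInclusion h x)) :=
  (FundamentalGroup.map (fibreInclusion h) x).range

/-- First integral homology of the punctured torus, as the abelianized fundamental group. -/
abbrev PuncturedTorus.H1 (x : PuncturedTorus) : Type :=
  Additive (Abelianization (FundamentalGroup PuncturedTorus x))

/-- The map `h₊` that `h` induces on first homology, for a base point fixed by `h`. -/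
noncomputable def homologyMap (h : PuncturedTorus ≃ₜ PuncturedTorus) {x : PuncturedTorus}
    (hx : h x = x) : PuncturedTorus.H1 x →ₗ[ℤ] PuncturedTorus.H1 x :=
  (MonoidHom.toAdditive (Abelianization.map
    (FundamentalGroup.mapOfEq (h : C(PuncturedTorus, PuncturedTorus)) hx))).toIntLinearMap

/-- The bundle with monodromy `h` is hyperbolic: `h` is of (pseudo-)Anosov type, that is, the
element `h₊` of `SL(2, ℤ)` by which it acts on `H₁(T; ℤ) ≅ ℤ²` satisfies `|tr h₊| > 2`. -/
def IsHyperbolicMonodromy (h : PuncturedTorus ≃ₜ PuncturedTorus) {x : PuncturedTorus}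
    (hx : h x = x) : Prop :=
  2 < |LinearMap.trace ℤ (PuncturedTorus.H1 x) (homologyMap h hx)|

open scoped commutatorElement
open CategoryTheory Set

section LinearlyOrderedGroup

variable {K : Type*} [Group K] [LinearOrder K] {C : Subgroup K}

theorem IsConvexSubgroup.mem_of_one_le (hC : IsConvexSubgroup (· < ·) C) {g c : K}
    (hc : c ∈ C) (h1 : 1 ≤ g) (h2 : g ≤ c) : g ∈ C := by
  rcases h1.eq_or_lt with rfl | h1
  · exact one_mem C
  rcases h2.eq_or_lt with rfl | h2
  · exact hc
  exact hC 1 (one_mem C) c hc g h1 h2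

variable [MulLeftMono K] [MulRightMono K]

theorem IsMaximalConvexSubgroup.exists_le_pow (hC : IsMaximalConvexSubgroup (· < ·) C) {u : K}
    (hu : 1 < u) (huC : u ∉ C) (g : K) : ∃ n : ℕ, g ≤ u ^ n := by
  obtain ⟨hconv, -, hmax⟩ := hC
  have hmono : ∀ n m : ℕ, u ^ n ≤ u ^ (n + m) := fun n m => by
    rw [pow_add]; exact le_mul_of_one_le_right' (one_le_pow_of_one_le' hu.le m)
  have hmono' : ∀ n m : ℕ, u ^ m ≤ u ^ (n + m) := fun n m => by
    rw [add_comm]; exact hmono m n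
  let D : Subgroup K :=
    { carrier := {g | ∃ n : ℕ, g ≤ u ^ n ∧ g⁻¹ ≤ u ^ n}
      one_mem' := ⟨0, by simp⟩
      inv_mem' := by
        rintro g ⟨n, h1, h2⟩
        exact ⟨n, h2, by simpa using h1⟩
      mul_mem' := by
        rintro a b ⟨n, h1, h2⟩ ⟨m, h3, h4⟩
        refine ⟨n + m, ?_, ?_⟩
        · rw [pow_add]; exact mul_le_mul' h1 h3
        · rw [mul_inv_rev, add_comm, pow_add]; exact mul_le_mul' h4 h2 }
  have hD : IsConvexSubgroup (· < ·) D := by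
    rintro a ⟨n, -, h2⟩ b ⟨m, h3, -⟩ g hag hgb
    refine ⟨n + m, (hgb.le.trans h3).trans (hmono' n m), ?_⟩
    exact ((inv_le_inv_iff.mpr hag.le).trans h2).trans (hmono n m)
  have key : ∀ c ∈ C, c ≤ u ^ 1 := fun c hc => by
    rw [pow_one]
    by_contra! h
    exact huC (hconv.mem_of_one_le hc hu.le h.le)
  have hCD : C ≤ D := fun c hc => ⟨1, key c hc, key _ (inv_mem hc)⟩
  have huD : u ∈ D := ⟨1, by simp, by
    rw [pow_one]; exact (inv_le_one'.mpr hu.le).trans hu.le⟩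
  rcases hmax D hD hCD with h | h
  · exact absurd (h ▸ huD) huC
  · have : g ∈ D := h ▸ Subgroup.mem_top g
    obtain ⟨n, hn, -⟩ := this
    exact ⟨n, hn⟩

theorem IsMaximalConvexSubgroup.exists_zpow_near (hC : IsMaximalConvexSubgroup (· < ·) C) {u : K}
    (hu : 1 < u) (huC : u ∉ C) (g : K) : ∃ m : ℤ, u ^ m ≤ g ∧ g < u ^ (m + 1) := by
  have hmono : StrictMono (fun m : ℤ => u ^ m) := strictMono_int_of_lt_succ fun n => by
    rw [zpow_add_one]; exact lt_mul_of_one_lt_right' _ hu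
  obtain ⟨n, hn⟩ := hC.exists_le_pow hu huC g
  obtain ⟨k, hk⟩ := hC.exists_le_pow hu huC g⁻¹
  obtain ⟨m, hm, hmax⟩ := Int.exists_greatest_of_bdd (P := fun m : ℤ => u ^ m ≤ g)
    ⟨n, fun z hz => hmono.le_iff_le.mp (by simpa using hz.trans hn)⟩
    ⟨-k, by simpa using inv_le_inv_iff.mpr hk⟩
  refine ⟨m, hm, ?_⟩
  by_contra! h
  have := hmax _ h
  omega

theorem IsMaximalConvexSubgroup.map_mem (hC : IsMaximalConvexSubgroup (· < ·) C)
    (σ : K ≃* K) (hσ : StrictMono σ) {u : K} (hu : u ∈ C) : σ u ∈ C := by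
  by_contra hv
  wlog h1 : 1 < σ u generalizing u
  · refine this (inv_mem hu) (by simpa using hv) ?_
    rw [map_inv, one_lt_inv']
    refine lt_of_le_of_ne (not_lt.mp h1) ?_
    rintro h
    exact hv (h ▸ one_mem C)
  have key : ∀ w : K, 1 ≤ w → w ∈ C := fun w hw => by
    obtain ⟨n, hn⟩ := hC.exists_le_pow h1 hv (σ w)
    rw [← map_pow, hσ.le_iff_le] at hn
    exact hC.1.mem_of_one_le (pow_mem hu n) hw hn
  refine hC.2.1 ((Subgroup.eq_top_iff' C).mpr fun w => ?_)
  rcases le_total 1 w with hw | hw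
  · exact key w hw
  · simpa using inv_mem (key w⁻¹ (by simpa using hw))

theorem IsMaximalConvexSubgroup.normal (hC : IsMaximalConvexSubgroup (· < ·) C) : C.Normal :=
  ⟨fun _ hn g => hC.map_mem (MulAut.conj g) (fun a b hab => by
    simpa using hab) hn⟩

theorem IsMaximalConvexSubgroup.commutator_le (hC : IsMaximalConvexSubgroup (· < ·) C) :
    commutator K ≤ C := by
  have hN := hC.normal
  rw [commutator_def, Subgroup.commutator_le]
  rintro a - b -
  by_contra hz
  wlog h1 : 1 < ⁅a, b⁆ generalizing a b
  · refine this b a (by rwa [← commutatorElement_inv, inv_mem_iff]) ?_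
    rw [← commutatorElement_inv, one_lt_inv']
    refine lt_of_le_of_ne (not_lt.mp h1) fun h => hz (h ▸ one_mem C)
  by_cases hy : ∃ y, 1 < y ∧ y ∉ C ∧ y * y ≤ ⁅a, b⁆
  · obtain ⟨y, hy1, hyC, hyz⟩ := hy
    obtain ⟨m, hm, hm'⟩ := hC.exists_zpow_near hy1 hyC a
    obtain ⟨n, hn, hn'⟩ := hC.exists_zpow_near hy1 hyC b
    refine absurd hyz (not_le.mpr ?_)
    calc ⁅a, b⁆ = a * b * a⁻¹ * b⁻¹ := rfl
      _ < y ^ (m + 1) * y ^ (n + 1) * (y ^ m)⁻¹ * (y ^ n)⁻¹ :=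
        mul_lt_mul_of_lt_of_le (mul_lt_mul_of_lt_of_le (mul_lt_mul_of_lt_of_lt hm' hn')
          (inv_le_inv_iff.mpr hm)) (inv_le_inv_iff.mpr hn)
      _ = y * y := by
        rw [← zpow_neg, ← zpow_neg, ← zpow_add, ← zpow_add, ← zpow_add,
          show m + 1 + (n + 1) + -m + -n = 2 by ring, zpow_two]
  · push Not at hy
    have hquot : ∀ g : K, ∃ m : ℤ, (g : K ⧸ C) = ((⁅a, b⁆ : K) : K ⧸ C) ^ m := by
      intro g
      obtain ⟨m, hm, hm'⟩ := hC.exists_zpow_near h1 hz g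
      set z := ⁅a, b⁆
      set y := (z ^ m)⁻¹ * g with hydef
      have hy1 : 1 ≤ y := by simpa [hydef] using hm
      have hyz : y < z := by
        rw [hydef, inv_mul_lt_iff_lt_mul, ← zpow_add_one]; exact hm'
      have hg : g = z ^ m * y := by simp [hydef]
      have hor : y ∈ C ∨ y⁻¹ * z ∈ C := by
        by_contra! hcon
        obtain ⟨h2, h3⟩ := hcon
        have hy1' : 1 < y := lt_of_le_of_ne hy1 fun h => h2 (h ▸ one_mem C)
        have h4 := hy y hy1' h2
        have h5 : 1 < y⁻¹ * z := by simpa using hyz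
        refine absurd (hy _ h5 h3) (not_lt.mpr ?_)
        have h6 : y⁻¹ * z < y := by rwa [inv_mul_lt_iff_lt_mul]
        calc y⁻¹ * z * (y⁻¹ * z) ≤ y * (y⁻¹ * z) := by gcongr
          _ = z := by simp
      rcases hor with h | h
      · refine ⟨m, ?_⟩
        rw [hg, QuotientGroup.mk_mul, QuotientGroup.mk_zpow, (QuotientGroup.eq_one_iff y).mpr h,
          mul_one]
      · refine ⟨m + 1, ?_⟩
        rw [hg, QuotientGroup.mk_mul, QuotientGroup.mk_zpow, QuotientGroup.eq.mpr h, zpow_add_one]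
    obtain ⟨m, hm⟩ := hquot a
    obtain ⟨n, hn⟩ := hquot b
    apply hz
    rw [← QuotientGroup.eq_one_iff]
    have : ((⁅a, b⁆ : K) : K ⧸ C) = ⁅(a : K ⧸ C), (b : K ⧸ C)⁆ := rfl
    rw [this, commutatorElement_eq_one_iff_mul_comm, hm, hn, ← zpow_add, ← zpow_add, add_comm]

/-- A linearly ordered group modulo a maximal convex subgroup embeds into the real numbers. -/
theorem IsMaximalConvexSubgroup.exists_real_hom (hC : IsMaximalConvexSubgroup (· < ·) C) :
    ∃ φ : K →* Multiplicative ℝ, (∀ g, φ g = 1 ↔ g ∈ C) ∧ ∀ g, 1 ≤ g → 1 ≤ φ g := by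
  have hN := hC.normal
  let _ : CommGroup (K ⧸ C) :=
    { (inferInstance : Group (K ⧸ C)) with
      mul_comm := fun a b => by
        induction a using QuotientGroup.induction_on with | _ a
        induction b using QuotientGroup.induction_on with | _ b
        rw [← commutatorElement_eq_one_iff_mul_comm]
        exact (QuotientGroup.eq_one_iff _).mpr (hC.commutator_le
          (Subgroup.commutator_mem_commutator (Subgroup.mem_top a) (Subgroup.mem_top b))) }
  let P : GroupCone (K ⧸ C) :=
    { carrier := {q | ∃ g : K, 1 ≤ g ∧ (g : K ⧸ C) = q}
      one_mem' := ⟨1, le_rfl, rfl⟩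
      mul_mem' := by
        rintro _ _ ⟨a, ha, rfl⟩ ⟨b, hb, rfl⟩
        exact ⟨a * b, one_le_mul ha hb, rfl⟩
      eq_one_of_mem_of_inv_mem' := by
        rintro _ ⟨a, ha, rfl⟩ ⟨b, hb, hab⟩
        rw [eq_inv_iff_mul_eq_one, ← QuotientGroup.mk_mul, QuotientGroup.eq_one_iff] at hab
        rw [QuotientGroup.eq_one_iff]
        exact hC.1.mem_of_one_le hab ha (le_mul_of_one_le_left' hb) }
  have : HasMemOrInvMem P := ⟨fun q => by
    induction q using QuotientGroup.induction_on with | _ a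
    rcases le_total 1 a with h | h
    · exact Or.inl ⟨a, h, rfl⟩
    · exact Or.inr ⟨a⁻¹, by simpa using h, rfl⟩⟩
  let _ : DecidablePred (· ∈ P) := Classical.decPred _
  let _ : LinearOrder (K ⧸ C) := LinearOrder.mkOfGroupCone P
  have : IsOrderedMonoid (K ⧸ C) := IsOrderedMonoid.mkOfCone P
  have hmk : Monotone (QuotientGroup.mk : K → K ⧸ C) := fun a b hab =>
    (PartialOrder.mkOfGroupCone_le_iff (C := P)).mpr ⟨a⁻¹ * b, by simpa using hab, by
      rw [QuotientGroup.mk_mul, QuotientGroup.mk_inv, mul_comm, div_eq_mul_inv]⟩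
  have : MulArchimedean (K ⧸ C) := ⟨fun q r hr => by
    induction q using QuotientGroup.induction_on with | _ a
    induction r using QuotientGroup.induction_on with | _ b
    have hb : 1 < b := by
      by_contra! h
      exact absurd (hmk h) (not_le.mpr hr)
    have hbC : b ∉ C := fun h => hr.ne' ((QuotientGroup.eq_one_iff b).mpr h)
    obtain ⟨n, hn⟩ := hC.exists_le_pow hb hbC a
    exact ⟨n, hmk hn⟩⟩
  obtain ⟨f, hf⟩ := Archimedean.exists_orderAddMonoidHom_real_injective (Additive (K ⧸ C))
  refine ⟨(AddMonoidHom.toMultiplicativeRight f.toAddMonoidHom).comp (QuotientGroup.mk' C), ?_, ?_⟩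
  · intro g
    rw [← QuotientGroup.eq_one_iff]
    change f (Additive.ofMul (g : K ⧸ C)) = 0 ↔ _
    rw [map_eq_zero_iff f hf]
    rfl
  · intro g hg
    have : f 0 ≤ f (Additive.ofMul (g : K ⧸ C)) := f.monotone' (hmk hg)
    rw [map_zero] at this
    exact this

end LinearlyOrderedGroup

/-- The linear order underlying a bi-order. -/
noncomputable abbrev IsBiOrder.toLinearOrder {K : Type*} [Group K] {lt : K → K → Prop}
    (hlt : IsBiOrder lt) : LinearOrder K where
  lt := lt
  le a b := lt a b ∨ a = b
  le_refl a := Or.inr rfl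
  le_trans a b c := by
    rintro (h | rfl) (h' | rfl)
    · exact Or.inl (hlt.trans _ _ _ h h')
    · exact Or.inl h
    · exact Or.inl h'
    · exact Or.inr rfl
  lt_iff_le_not_ge a b := by
    constructor
    · refine fun h => ⟨Or.inl h, ?_⟩
      rintro (h' | rfl)
      · exact hlt.irrefl _ (hlt.trans _ _ _ h h')
      · exact hlt.irrefl _ h
    · rintro ⟨h | rfl, h'⟩
      · exact h
      · exact absurd (Or.inr rfl) h'
  le_antisymm a b := by
    rintro (h | rfl) (h' | h')
    · exact absurd (hlt.trans _ _ _ h h') (hlt.irrefl _)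
    · exact h'.symm
    · rfl
    · rfl
  le_total a b := by
    rcases hlt.total a b with h | h | h
    · exact Or.inl (Or.inl h)
    · exact Or.inl (Or.inr h)
    · exact Or.inr (Or.inl h)
  toDecidableLE := Classical.decRel _

theorem IsBiOrder.induced {Γ : Type*} [Group Γ] {lt : Γ → Γ → Prop} (hlt : IsBiOrder lt)
    (H : Subgroup Γ) : IsBiOrder (inducedOrder lt H) where
  irrefl a := hlt.irrefl _
  trans a b c := hlt.trans _ _ _
  total a b := by
    rcases hlt.total (a : Γ) b with h | h | h
    · exact Or.inl h
    · exact Or.inr (Or.inl (Subtype.ext h))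
    · exact Or.inr (Or.inr h)
  mul_left g a b := hlt.mul_left _ _ _
  mul_right g a b := hlt.mul_right _ _ _

theorem IsBiOrder.mulLeftMono {K : Type*} [Group K] {lt : K → K → Prop} (hlt : IsBiOrder lt) :
    letI := hlt.toLinearOrder
    MulLeftMono K :=
  letI := hlt.toLinearOrder
  ⟨fun g a b h => h.imp (hlt.mul_left g a b) (fun h => by rw [h])⟩

theorem IsBiOrder.mulRightMono {K : Type*} [Group K] {lt : K → K → Prop} (hlt : IsBiOrder lt) :
    letI := hlt.toLinearOrder
    MulRightMono K :=
  letI := hlt.toLinearOrder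
  ⟨fun g a b h => h.imp (hlt.mul_right g a b) (fun h => by subst h; rfl)⟩

/-- A real-valued homomorphism that is monotone for a linear order of a group is multiplied by a
positive number under an order-preserving automorphism that preserves its kernel. -/
theorem exists_scale_factor {K : Type*} [Group K] [LinearOrder K] [MulLeftMono K] [MulRightMono K]
    (φ : K →* Multiplicative ℝ) (hφ : ∀ g, 1 ≤ g → 1 ≤ φ g) (hne : ∃ g, φ g ≠ 1)
    (σ : K ≃* K) (hσ : StrictMono σ) (hker : ∀ g, φ (σ g) = 1 → φ g = 1) :
    ∃ r : ℝ, 0 < r ∧ ∀ k, (φ (σ k)).toAdd = r * (φ k).toAdd := by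
  have hpos : ∀ g, 0 < (φ g).toAdd → 1 < g := fun g hg => by
    by_contra! h
    have h2 : 0 ≤ (φ g⁻¹).toAdd := hφ g⁻¹ (by simpa using h)
    rw [map_inv, toAdd_inv] at h2
    linarith
  have hσ1 : ∀ g, 0 < (φ g).toAdd → 0 ≤ (φ (σ g)).toAdd := fun g hg => hφ _ (by
    have := hσ (hpos g hg); rw [map_one] at this; exact this.le)
  obtain ⟨u, hu⟩ : ∃ u, 0 < (φ u).toAdd := by
    obtain ⟨g, hg⟩ := hne
    have hg' : (φ g).toAdd ≠ 0 := hg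
    rcases lt_or_gt_of_ne hg' with h | h
    · exact ⟨g⁻¹, by rw [map_inv, toAdd_inv]; linarith⟩
    · exact ⟨g, h⟩
  have hv : 0 < (φ (σ u)).toAdd := by
    refine lt_of_le_of_ne (hσ1 u hu) fun h => hu.ne' ?_
    have h2 : φ (σ u) = 1 := h.symm
    rw [hker u h2]; rfl
  have hle : ∀ k, (φ k).toAdd / (φ u).toAdd ≤ (φ (σ k)).toAdd / (φ (σ u)).toAdd := by
    intro k
    by_contra! h
    obtain ⟨q, hq1, hq2⟩ := exists_rat_btwn h
    have hd : (0 : ℝ) < q.den := by exact_mod_cast q.den_pos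
    rw [Rat.cast_def, div_lt_div_iff₀ hv hd] at hq1
    rw [Rat.cast_def, div_lt_div_iff₀ hd hu] at hq2
    have h3 := hσ1 (k ^ q.den * (u ^ q.num)⁻¹) (by
      simp only [map_mul, map_pow, map_inv, map_zpow, toAdd_mul, toAdd_pow, toAdd_inv, toAdd_zpow,
        nsmul_eq_mul, zsmul_eq_mul]
      linarith)
    simp only [map_mul, map_pow, map_inv, map_zpow, toAdd_mul, toAdd_pow, toAdd_inv, toAdd_zpow,
      nsmul_eq_mul, zsmul_eq_mul] at h3
    linarith
  refine ⟨(φ (σ u)).toAdd / (φ u).toAdd, div_pos hv hu, fun k => ?_⟩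
  have heq : (φ k).toAdd / (φ u).toAdd = (φ (σ k)).toAdd / (φ (σ u)).toAdd := by
    refine le_antisymm (hle k) ?_
    have := hle k⁻¹
    simp only [map_inv, toAdd_inv, neg_div] at this
    linarith
  field_simp at heq ⊢
  linarith

/-- The normalizer of a subgroup scales a real-valued homomorphism whose kernel is a maximal convex
subgroup. -/
theorem IsMaximalConvexSubgroup.exists_scaling_hom {Γ : Type*} [Group Γ] {lt : Γ → Γ → Prop}
    (hlt : IsBiOrder lt) {K : Subgroup Γ} {C : Subgroup K}
    (hC : IsMaximalConvexSubgroup (inducedOrder lt K) C) :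
    ∃ (φ : K →* Multiplicative ℝ) (Λ : Subgroup.normalizer (K : Set Γ) →* Multiplicative ℝ),
      (∀ g, φ g = 1 ↔ g ∈ C) ∧
      ∀ n k, (φ (K.normalizerMonoidHom n k)).toAdd = Real.exp (Λ n).toAdd * (φ k).toAdd := by
  let _ := (hlt.induced K).toLinearOrder
  have := (hlt.induced K).mulLeftMono
  have := (hlt.induced K).mulRightMono
  have hC' : IsMaximalConvexSubgroup (· < ·) C := hC
  obtain ⟨φ, hker, hmono⟩ := hC'.exists_real_hom
  have hne : ∃ g, φ g ≠ 1 := by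
    by_contra! h
    exact hC.2.1 ((Subgroup.eq_top_iff' C).mpr fun g => (hker g).mp (h g))
  have hσ : ∀ n, StrictMono (K.normalizerMonoidHom n) := fun n a b hab =>
    hlt.mul_right _ _ _ (hlt.mul_left _ _ _ hab)
  have hscale : ∀ n, ∃ r : ℝ, 0 < r ∧
      ∀ k, (φ (K.normalizerMonoidHom n k)).toAdd = r * (φ k).toAdd := fun n =>
    exists_scale_factor φ hmono hne _ (hσ n) fun g hg => by
      rw [hker] at hg ⊢
      have := hC'.map_mem (K.normalizerMonoidHom n⁻¹) (hσ _) hg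
      rwa [map_inv, MulAut.inv_apply_self] at this
  choose r hr hrφ using hscale
  obtain ⟨u, hu⟩ := hne
  have hu' : (φ u).toAdd ≠ 0 := hu
  refine ⟨φ, MonoidHom.mk' (fun n => Multiplicative.ofAdd (Real.log (r n))) fun m n => ?_, hker,
    fun n k => ?_⟩
  · rw [← ofAdd_add, ← Real.log_mul (hr m).ne' (hr n).ne']
    congr 2
    apply mul_right_cancel₀ hu'
    rw [← hrφ, map_mul, MulAut.mul_apply, hrφ, hrφ, mul_assoc]
  · rw [hrφ]
    simp [Real.exp_log (hr n)]

/-- In a group generated by two elements, the derived subgroup is cyclic modulo the next term of the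
lower central series, generated by the commutator of the generators. -/
theorem commutator_le_sup_zpowers {F : Type*} [Group F] {a b : F}
    (hab : Subgroup.closure {a, b} = ⊤) :
    commutator F ≤ ⁅commutator F, (⊤ : Subgroup F)⁆ ⊔ Subgroup.zpowers ⁅a, b⁆ := by
  set N := ⁅commutator F, (⊤ : Subgroup F)⁆ ⊔ Subgroup.zpowers ⁅a, b⁆ with hN
  have hle : N ≤ commutator F := sup_le (Subgroup.commutator_le_left _ _) (by
    rw [Subgroup.zpowers_le]
    exact Subgroup.commutator_mem_commutator (Subgroup.mem_top a) (Subgroup.mem_top b))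
  have hnormal : N.Normal := ⟨fun n hn g => by
    have h1 : ⁅n, g⁆ ∈ N := Subgroup.mem_sup_left
      (Subgroup.commutator_mem_commutator (hle hn) (Subgroup.mem_top g))
    have : g * n * g⁻¹ = ⁅n, g⁆⁻¹ * n := by simp [commutatorElement_def, mul_assoc]
    rw [this]
    exact mul_mem (inv_mem h1) hn⟩
  let π := QuotientGroup.mk' N
  have hcomm : π a * π b = π b * π a := by
    rw [← commutatorElement_eq_one_iff_mul_comm, ← map_commutatorElement]
    exact (QuotientGroup.eq_one_iff _).mpr (Subgroup.mem_sup_right (Subgroup.mem_zpowers _))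
  have hgen : ∀ H : Subgroup (F ⧸ N), π a ∈ H → π b ∈ H → ∀ x, π x ∈ H := by
    intro H ha hb x
    have h : Subgroup.closure {a, b} ≤ H.comap π := by
      rw [Subgroup.closure_le]
      rintro y (rfl | rfl)
      · exact ha
      · exact hb
    rw [hab] at h
    exact h (Subgroup.mem_top x)
  have ha := hgen (Subgroup.centralizer {π a}) (by simp [Subgroup.mem_centralizer_iff])
    (by simp [Subgroup.mem_centralizer_iff, hcomm])
  have hb := hgen (Subgroup.centralizer {π b}) (by simp [Subgroup.mem_centralizer_iff, hcomm])
    (by simp [Subgroup.mem_centralizer_iff])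
  have hall : ∀ x y, π y * π x = π x * π y := by
    intro x y
    have := hgen (Subgroup.centralizer {π y})
      (by simpa [Subgroup.mem_centralizer_iff] using (ha y _ rfl).symm)
      (by simpa [Subgroup.mem_centralizer_iff] using (hb y _ rfl).symm) x
    simpa [Subgroup.mem_centralizer_iff] using this
  rw [commutator_def, Subgroup.commutator_le]
  rintro x - y -
  rw [← QuotientGroup.eq_one_iff]
  change π ⁅x, y⁆ = 1
  rw [map_commutatorElement, commutatorElement_eq_one_iff_mul_comm]
  exact hall y x

/-- Let `t` act on the image `G` of a two-generator group by an endomorphism with no nontrivial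
invariant real-valued homomorphism. Then a maximal convex subgroup of `[G, G]` is `[[G, G], G]`. -/
theorem IsMaximalConvexSubgroup.map_subtype_eq_commutator {Γ F : Type*} [Group Γ] [Group F]
    {lt : Γ → Γ → Prop} (hlt : IsBiOrder lt) (f : F →* Γ) (θ : F →* F)
    (hθ : Function.Surjective θ) (t : Γ) (ht : ∀ g, t * f g * t⁻¹ = f (θ g)) {a b : F}
    (hab : Subgroup.closure {a, b} = ⊤)
    (hinv : ∀ L : F →* Multiplicative ℝ, (∀ g, L (θ g) = L g) → L = 1)
    {K : Subgroup Γ} (hK : K = ⁅f.range, f.range⁆) {C : Subgroup K}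
    (hC : IsMaximalConvexSubgroup (inducedOrder lt K) C) :
    C.map K.subtype = ⁅K, f.range⁆ := by
  obtain ⟨φ, Λ, hker, hΛ⟩ := hC.exists_scaling_hom hlt
  have hnorm : ∀ n : Γ, f.range.map (MulAut.conj n).toMonoidHom = f.range →
      n ∈ Subgroup.normalizer (K : Set Γ) := fun n hn => by
    rw [Subgroup.mem_normalizer_iff_map_conj_eq]
    change K.map (MulAut.conj n).toMonoidHom = K
    rw [hK, Subgroup.map_commutator, hn]
  have htN : t ∈ Subgroup.normalizer (K : Set Γ) := by
    apply hnorm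
    have h1 : (MulAut.conj t).toMonoidHom.comp f = f.comp θ := MonoidHom.ext ht
    rw [← MonoidHom.range_comp, h1, MonoidHom.range_comp, MonoidHom.range_eq_top.mpr hθ,
      ← MonoidHom.range_eq_map]
  have hfN : ∀ g, f g ∈ Subgroup.normalizer (K : Set Γ) := fun g => by
    apply hnorm
    have h1 : (MulAut.conj (f g)).toMonoidHom.comp f = f.comp (MulAut.conj g).toMonoidHom :=
      MonoidHom.ext fun x => by simp
    rw [← MonoidHom.range_comp, h1, MonoidHom.range_comp,
      MonoidHom.range_eq_top.mpr (MulAut.conj g).surjective, ← MonoidHom.range_eq_map]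
  have hL : Λ.comp (f.codRestrict _ hfN) = 1 := hinv _ fun g => by
    have : f.codRestrict _ hfN (θ g) = ⟨t, htN⟩ * f.codRestrict _ hfN g * ⟨t, htN⟩⁻¹ :=
      Subtype.ext (ht g).symm
    simp only [MonoidHom.comp_apply]
    rw [this, map_mul, map_mul, map_inv, mul_inv_cancel_comm]
  have hK3 : ⁅K, f.range⁆ ≤ C.map K.subtype := by
    rw [Subgroup.commutator_le]
    rintro k hk _ ⟨g, rfl⟩
    have h1 : Λ ⟨f g, hfN g⟩ = 1 := DFunLike.congr_fun hL g
    have h2 := hΛ ⟨f g, hfN g⟩ ⟨k, hk⟩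
    rw [h1, toAdd_one, Real.exp_zero, one_mul] at h2
    refine ⟨⟨k, hk⟩ * (K.normalizerMonoidHom ⟨f g, hfN g⟩ ⟨k, hk⟩)⁻¹, ?_, ?_⟩
    · change _ ∈ C
      rw [← hker, map_mul, map_inv, mul_inv_eq_one]
      exact h2.symm
    · change k * (f g * k * (f g)⁻¹)⁻¹ = _
      simp [commutatorElement_def, mul_assoc]
  have hF2 : (commutator F).map f = K := by
    rw [commutator_def, Subgroup.map_commutator, ← MonoidHom.range_eq_map, hK]
  have hF3 : ⁅commutator F, (⊤ : Subgroup F)⁆.map f = ⁅K, f.range⁆ := by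
    rw [Subgroup.map_commutator, hF2, ← MonoidHom.range_eq_map]
  have hφ3 : ∀ k : K, (k : Γ) ∈ ⁅K, f.range⁆ → φ k = 1 := fun k hk => by
    obtain ⟨c, hc, hck⟩ := hK3 hk
    rw [hker, ← show c = k from Subtype.ext hck]
    exact hc
  have hcK : f ⁅a, b⁆ ∈ K := by
    rw [map_commutatorElement, hK]
    exact Subgroup.commutator_mem_commutator ⟨a, rfl⟩ ⟨b, rfl⟩
  have hcyc : ∀ k : K, ∃ m : ℤ, ∃ w : K, (w : Γ) ∈ ⁅K, f.range⁆ ∧ k = w * ⟨f ⁅a, b⁆, hcK⟩ ^ m := by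
    rintro ⟨k, hk⟩
    have hk' := hk
    rw [← hF2] at hk'
    obtain ⟨y, hy, rfl⟩ := hk'
    obtain ⟨w, hw, _, ⟨m, rfl⟩, rfl⟩ :=
      Subgroup.mem_sup_of_normal_left.mp (commutator_le_sup_zpowers hab hy)
    have hw3 : f w ∈ ⁅K, f.range⁆ := hF3 ▸ Subgroup.mem_map_of_mem f hw
    have hwK : f w ∈ K := hF2 ▸ Subgroup.mem_map_of_mem f (Subgroup.commutator_le_left _ _ hw)
    exact ⟨m, ⟨f w, hwK⟩, hw3, Subtype.ext (by simp)⟩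
  have hφc : (φ ⟨f ⁅a, b⁆, hcK⟩).toAdd ≠ 0 := fun h => by
    have h' : φ ⟨f ⁅a, b⁆, hcK⟩ = 1 := h
    refine hC.2.1 ((Subgroup.eq_top_iff' C).mpr fun k => ?_)
    obtain ⟨m, w, hw, rfl⟩ := hcyc k
    rw [← hker, map_mul, map_zpow, hφ3 w hw, h', one_zpow, one_mul]
  refine le_antisymm ?_ hK3
  rintro _ ⟨k, hk, rfl⟩
  obtain ⟨m, w, hw, rfl⟩ := hcyc k
  have h1 := (hker _).mpr hk
  rw [map_mul, map_zpow, hφ3 w hw, one_mul] at h1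
  have h2 : m • (φ ⟨f ⁅a, b⁆, hcK⟩).toAdd = 0 := by rw [← toAdd_zpow, h1]; rfl
  have h3 : m = 0 := (smul_eq_zero.mp h2).resolve_right hφc
  subst h3
  simpa using hw

/-- A surjective endomorphism of a two-generator abelian group whose trace exceeds two in absolute
value has no nonzero invariant real-valued homomorphism. -/
theorem eq_zero_of_two_lt_abs_trace {A : Type*} [AddCommGroup A] {a b : A}
    (hab : Submodule.span ℤ {a, b} = ⊤) (e : A →ₗ[ℤ] A) (he : Function.Surjective e)
    (htr : 2 < |LinearMap.trace ℤ A e|) (ψ : A →+ ℝ) (hψ : ∀ v, ψ (e v) = ψ v) : ψ = 0 := by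
  classical
  have H : ∃ s : Finset A, Nonempty (Module.Basis s ℤ A) := by
    by_contra H
    simp [LinearMap.trace, H] at htr
  obtain ⟨s, ⟨B⟩⟩ := H
  have : Module.Free ℤ A := Module.Free.of_basis B
  have : Module.Finite ℤ A := Module.Finite.of_basis B
  have hrank : Module.finrank ℤ A ≤ 2 := by
    have h1 := finrank_span_le_card (R := ℤ) ({a, b} : Set A)
    rw [hab, finrank_top] at h1
    refine h1.trans ?_
    rw [Set.toFinset_card, Fintype.card_eq_nat_card, Nat.card_coe_set_eq]
    exact (Set.ncard_insert_le a {b}).trans (by simp)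
  have hdet : IsUnit (LinearMap.det e) :=
    LinearEquiv.isUnit_det' (LinearEquiv.ofBijective e
      (OrzechProperty.bijective_of_surjective_endomorphism e he))
  let β := Module.finBasis ℤ A
  have hsum : ∀ j, ∑ i, (LinearMap.toMatrix β β e i j : ℝ) * ψ (β i) = ψ (β j) := fun j => by
    rw [← hψ (β j), ← β.sum_repr (e (β j)), map_sum]
    refine Finset.sum_congr rfl fun i _ => ?_
    rw [map_zsmul, LinearMap.toMatrix_apply, zsmul_eq_mul]
  rw [← LinearMap.det_toMatrix β] at hdet
  rw [LinearMap.trace_eq_matrix_trace ℤ β] at htr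
  suffices h : ∀ i, ψ (β i) = 0 by
    ext v
    rw [← β.sum_repr v, map_sum]
    exact Finset.sum_eq_zero fun i _ => by rw [map_zsmul, h i, smul_zero]
  generalize LinearMap.toMatrix β β e = M at *
  generalize hβ : (fun i => ψ (β i)) = x at *
  have hx : ∀ i, ψ (β i) = x i := fun i => congrFun hβ i
  simp only [hx] at hsum ⊢
  clear hx hβ
  clear_value β
  clear β
  generalize Module.finrank ℤ A = n at *
  rw [Int.isUnit_iff] at hdet
  interval_cases n
  · simp at htr
  · simp only [Matrix.trace_fin_one, Matrix.det_fin_one] at htr hdet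
    rcases hdet with h | h <;> simp [h] at htr
  · simp only [Matrix.trace_fin_two, Matrix.det_fin_two] at htr hdet
    simp only [Fin.sum_univ_two, Fin.forall_fin_two] at hsum ⊢
    obtain ⟨h0, h1⟩ := hsum
    have hne : (M 0 0 - 1) * (M 1 1 - 1) - M 0 1 * M 1 0 ≠ 0 := by
      intro h
      have h3 : M 0 0 + M 1 1 = (M 0 0 * M 1 1 - M 0 1 * M 1 0) + 1 := by linarith
      rw [h3] at htr
      rcases hdet with h | h <;> simp [h] at htr
    have hne' : ((M 0 0 : ℝ) - 1) * (M 1 1 - 1) - M 0 1 * M 1 0 ≠ 0 := by exact_mod_cast hne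
    constructor
    · apply (mul_eq_zero.mp _).resolve_left hne'
      linear_combination ((M 1 1 : ℝ) - 1) * h0 - (M 1 0 : ℝ) * h1
    · apply (mul_eq_zero.mp _).resolve_left hne'
      linear_combination ((M 0 0 : ℝ) - 1) * h1 - (M 0 1 : ℝ) * h0

instance : ContractibleSpace unitInterval :=
  (convex_Icc (0 : ℝ) 1).contractibleSpace ⟨0, by simp⟩

section Transport

variable {X S R : Type*} [TopologicalSpace X] [TopologicalSpace S] [TopologicalSpace R]
  [SimplyConnectedSpace S] [SimplyConnectedSpace R]

/-- The homotopy class of the image of a path between two points of a simply connected space. -/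
noncomputable def transportAlong (f : C(S, X)) (u v : S) {y z : X} (hu : f u = y) (hv : f v = z) :
    FundamentalGroupoid.mk y ⟶ FundamentalGroupoid.mk z :=
  (Path.Homotopic.Quotient.mk ((PathConnectedSpace.somePath u v).map f.continuous)).cast
    hu.symm hv.symm

theorem transportAlong_eq_map (f : C(S, X)) {u v : S}
    (p : FundamentalGroupoid.mk u ⟶ FundamentalGroupoid.mk v) :
    transportAlong f u v rfl rfl = (FundamentalGroupoid.map f).map p := by
  rw [Subsingleton.elim (α := Path.Homotopic.Quotient u v) p
    (Path.Homotopic.Quotient.mk (PathConnectedSpace.somePath u v))]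
  exact Path.Homotopic.Quotient.cast_rfl_rfl _

theorem transportAlong_comp (f : C(S, X)) {u v w : S} {y z s : X} (hu : f u = y) (hv : f v = z)
    (hw : f w = s) :
    transportAlong f u v hu hv ≫ transportAlong f v w hv hw = transportAlong f u w hu hw := by
  subst hu hv hw
  let p : FundamentalGroupoid.mk u ⟶ FundamentalGroupoid.mk v :=
    Path.Homotopic.Quotient.mk (PathConnectedSpace.somePath u v)
  let q : FundamentalGroupoid.mk v ⟶ FundamentalGroupoid.mk w :=
    Path.Homotopic.Quotient.mk (PathConnectedSpace.somePath v w)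
  rw [transportAlong_eq_map f p, transportAlong_eq_map f q, transportAlong_eq_map f (p ≫ q)]
  exact ((FundamentalGroupoid.map f).map_comp p q).symm

theorem transportAlong_self (f : C(S, X)) {u : S} {y : X} (hu hu' : f u = y) :
    transportAlong f u u hu hu' = 𝟙 _ := by
  subst hu
  rw [transportAlong_eq_map f (𝟙 _)]
  exact (FundamentalGroupoid.map f).map_id _

theorem inv_transportAlong (f : C(S, X)) {u v : S} {y z : X} (hu : f u = y) (hv : f v = z) :
    inv (transportAlong f u v hu hv) = transportAlong f v u hv hu := by
  rw [IsIso.inv_eq_of_hom_inv_id]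
  rw [transportAlong_comp, transportAlong_self]

theorem transportAlong_comp_map (f : C(S, X)) (g : C(R, S)) {u v : R} {y z : X}
    (hu : f (g u) = y) (hv : f (g v) = z) :
    transportAlong (f.comp g) u v hu hv = transportAlong f (g u) (g v) hu hv := by
  subst hu hv
  let p : FundamentalGroupoid.mk u ⟶ FundamentalGroupoid.mk v :=
    Path.Homotopic.Quotient.mk (PathConnectedSpace.somePath u v)
  rw [transportAlong_eq_map f ((FundamentalGroupoid.map g).map p)]
  exact (transportAlong_eq_map (f.comp g) p).trans
    (Path.Homotopic.Quotient.map_comp (p := p) (f := g) (g := f)).symm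

theorem transportAlong_eq_of_comp_eq {S' : Type*} [TopologicalSpace S'] [SimplyConnectedSpace S']
    (f : C(S, X)) (f' : C(S', X)) (g : C(R, S)) (g' : C(R, S')) (h : ∀ r, f (g r) = f' (g' r))
    {u v : R} {y z : X} (hu : f (g u) = y) (hv : f (g v) = z) :
    transportAlong f (g u) (g v) hu hv =
      transportAlong f' (g' u) (g' v) ((h u).symm.trans hu) ((h v).symm.trans hv) := by
  rw [← transportAlong_comp_map, ← transportAlong_comp_map]
  have : f.comp g = f'.comp g' := ContinuousMap.ext h
  congr 1

theorem transportAlong_path {x y : X} (γ : Path x y) :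
    transportAlong γ.toContinuousMap 0 1 γ.source γ.target = Path.Homotopic.Quotient.mk γ := by
  let p : Path (0 : unitInterval) 1 := ⟨ContinuousMap.id _, rfl, rfl⟩
  have h : Path.Homotopic.Quotient.mk (PathConnectedSpace.somePath (0 : unitInterval) 1) =
      Path.Homotopic.Quotient.mk p := Subsingleton.elim _ _
  have h2 : (Path.Homotopic.Quotient.mk ((PathConnectedSpace.somePath (0 : unitInterval) 1).map
      γ.toContinuousMap.continuous)) =
      Path.Homotopic.Quotient.mk (p.map γ.toContinuousMap.continuous) :=
    congrArg (fun P => Path.Homotopic.Quotient.map P γ.toContinuousMap) h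
  unfold transportAlong
  rw [h2]
  rfl

/-- A loop lies in a subgroup of the fundamental group if all its short pieces, closed up by chosen
paths from the base point, do. -/
theorem mem_subgroup_of_locally {x : X} (H : Subgroup (FundamentalGroup X x))
    (q : ∀ y, FundamentalGroupoid.mk x ⟶ FundamentalGroupoid.mk y) (hq : q x = 𝟙 _)
    (γ : Path x x)
    (hloc : ∀ t₀ : unitInterval, ∃ J ∈ nhds t₀, ∀ t ∈ J, ∀ t' ∈ J,
      (q (γ t) ≫ transportAlong γ.toContinuousMap t t' rfl rfl ≫ inv (q (γ t')) :
        FundamentalGroup X x) ∈ H) :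
    (Path.Homotopic.Quotient.mk γ : FundamentalGroup X x) ∈ H := by
  let F : unitInterval → FundamentalGroup X x := fun t =>
    transportAlong γ.toContinuousMap 0 t γ.source rfl ≫ inv (q (γ t))
  let W : unitInterval → unitInterval → FundamentalGroup X x := fun t t' =>
    q (γ t) ≫ transportAlong γ.toContinuousMap t t' rfl rfl ≫ inv (q (γ t'))
  have hF : ∀ t t', F t' = W t t' * F t := by
    intro t t'
    change F t' = F t ≫ W t t'
    simp only [F, W]
    rw [← transportAlong_comp γ.toContinuousMap γ.source (v := t) rfl rfl]
    simp
  have hclopen : IsClopen {t | F t ∈ H} := by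
    constructor
    · rw [← isOpen_compl_iff, isOpen_iff_mem_nhds]
      intro t₀ ht₀
      obtain ⟨J, hJ, hJ'⟩ := hloc t₀
      filter_upwards [hJ] with t ht
      intro h
      apply ht₀
      change F t₀ ∈ H
      rw [hF t t₀]
      exact mul_mem (hJ' t ht t₀ (mem_of_mem_nhds hJ)) h
    · rw [isOpen_iff_mem_nhds]
      intro t₀ ht₀
      obtain ⟨J, hJ, hJ'⟩ := hloc t₀
      filter_upwards [hJ] with t ht
      rw [hF t₀ t]
      exact mul_mem (hJ' t₀ (mem_of_mem_nhds hJ) t ht) ht₀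
  have hq' : ∀ y (h : y = x), inv (q y) = eqToHom (congrArg FundamentalGroupoid.mk h) := by
    rintro _ rfl
    rw [hq]; simp
  have h0 : F 0 ∈ H := by
    have : F 0 = 1 := by
      simp only [F]
      rw [hq' _ γ.source]
      have : ∀ y (h : γ.toContinuousMap 0 = y),
          transportAlong γ.toContinuousMap 0 0 h rfl ≫
            eqToHom (congrArg FundamentalGroupoid.mk h) = 𝟙 _ := by
        rintro _ rfl
        rw [transportAlong_self]; simp
      exact this x γ.source
    rw [this]; exact one_mem H
  have h1 : F 1 = (Path.Homotopic.Quotient.mk γ : FundamentalGroup X x) := by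
    simp only [F]
    rw [hq' _ γ.target, ← transportAlong_path]
    have : ∀ y (h : γ.toContinuousMap 1 = y),
        transportAlong γ.toContinuousMap 0 1 γ.source rfl ≫
          eqToHom (congrArg FundamentalGroupoid.mk h) =
            transportAlong γ.toContinuousMap 0 1 γ.source h := by
      rintro _ rfl
      simp
    exact this x γ.target
  rw [← h1]
  exact (hclopen.eq_univ ⟨0, h0⟩).ge (Set.mem_univ (1 : unitInterval))

/-- Let `S` be a simply connected space over `X` that is the union of two simply connected pieces,
each of which factors through a simply connected space `Q` over `X`. Then the paths in `S`, closed
up by paths in `Q`, lie in one cyclic subgroup of the fundamental group. -/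
theorem exists_zpowers_of_two_pieces {Q P N : Type*} [TopologicalSpace Q] [TopologicalSpace P]
    [TopologicalSpace N] [SimplyConnectedSpace Q] [SimplyConnectedSpace P] [SimplyConnectedSpace N]
    {x : X} (fQ : C(Q, X)) (fS : C(S, X)) (x' : Q) (hx : fQ x' = x)
    (q : ∀ y, FundamentalGroupoid.mk x ⟶ FundamentalGroupoid.mk y)
    (hq : ∀ (k : Q) y (h : fQ k = y), q y = transportAlong fQ x' k hx h)
    (iP : C(P, S)) (jP : C(P, Q)) (hP : ∀ p, fS (iP p) = fQ (jP p))
    (iN : C(N, S)) (jN : C(N, Q)) (hN : ∀ p, fS (iN p) = fQ (jN p))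
    (hcov : ∀ s, (∃ p, iP p = s) ∨ ∃ n, iN n = s) :
    ∃ a : FundamentalGroup X x, ∀ s s' y y' (hs : fS s = y) (hs' : fS s' = y'),
      (q y ≫ transportAlong fS s s' hs hs' ≫ inv (q y') : FundamentalGroup X x) ∈
        Subgroup.zpowers a := by
  obtain ⟨p₀⟩ : Nonempty P := inferInstance
  obtain ⟨n₀⟩ : Nonempty N := inferInstance
  let c := transportAlong fQ x' (jP p₀) hx (hP p₀).symm
  let c' := transportAlong fQ x' (jN n₀) hx rfl ≫
    transportAlong fS (iN n₀) (iP p₀) (hN n₀) rfl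
  have key : ∀ s y (hs : fS s = y), q y ≫ transportAlong fS s (iP p₀) hs rfl = c ∨
      q y ≫ transportAlong fS s (iP p₀) hs rfl = c' := by
    intro s y hs
    rcases hcov s with ⟨p, rfl⟩ | ⟨n, rfl⟩
    · left
      rw [hq (jP p) y ((hP p).symm.trans hs), transportAlong_eq_of_comp_eq fS fQ iP jP hP,
        transportAlong_comp]
    · right
      rw [hq (jN n) y ((hN n).symm.trans hs),
        ← transportAlong_comp fS hs (hN n₀) rfl, transportAlong_eq_of_comp_eq fS fQ iN jN hN,
        ← Category.assoc, transportAlong_comp]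
  let a : FundamentalGroup X x := c' ≫ inv c
  refine ⟨a, fun s s' y y' hs hs' => ?_⟩
  have h1 : q y ≫ transportAlong fS s s' hs hs' ≫ inv (q y') =
      (q y ≫ transportAlong fS s (iP p₀) hs rfl) ≫
        inv (q y' ≫ transportAlong fS s' (iP p₀) hs' rfl) := by
    rw [IsIso.inv_comp, inv_transportAlong, Category.assoc,
      ← Category.assoc (transportAlong fS s (iP p₀) hs rfl), transportAlong_comp]
  rw [h1]
  rcases key s y hs with h | h <;> rcases key s' y' hs' with h' | h' <;> simp only [h, h']
  · rw [IsIso.hom_inv_id]; exact one_mem _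
  · let d : FundamentalGroup X x := c ≫ inv c'
    have hd : d * a = 1 := by
      change (c' ≫ inv c) ≫ (c ≫ inv c') = 𝟙 _
      simp
    change d ∈ _
    rw [eq_inv_of_mul_eq_one_left hd]
    exact inv_mem (Subgroup.mem_zpowers a)
  · exact Subgroup.mem_zpowers a
  · rw [IsIso.hom_inv_id]; exact one_mem _

end Transport

section PuncturedTorus

theorem UnitAddCircle.coe_sub_intCast (s : ℝ) (m : ℤ) :
    ((s - m : ℝ) : UnitAddCircle) = s := by
  rw [AddCircle.coe_sub, sub_eq_self, AddCircle.coe_eq_zero_iff]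
  exact ⟨m, by simp⟩

theorem UnitAddCircle.norm_coe_le_abs_sub (s : ℝ) (m : ℤ) : ‖(s : UnitAddCircle)‖ ≤ |s - m| := by
  rw [UnitAddCircle.norm_eq]
  exact round_le s m

theorem UnitAddCircle.quarter_le_norm {s : ℝ} (hs : s ∈ Icc (1 / 4 : ℝ) (3 / 4)) :
    1 / 4 ≤ ‖(s : UnitAddCircle)‖ := by
  rw [UnitAddCircle.norm_eq, le_abs]
  obtain ⟨h1, h2⟩ := hs
  rcases le_or_gt (round s) 0 with h | h
  · left
    have : ((round s : ℤ) : ℝ) ≤ 0 := by exact_mod_cast h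
    linarith
  · right
    have : (1 : ℝ) ≤ (round s : ℤ) := by exact_mod_cast h
    linarith

theorem UnitAddCircle.mem_Icc_of_quarter_le_norm {s : ℝ} (hs : s ∈ Ico (0 : ℝ) 1)
    (h : 1 / 4 ≤ ‖(s : UnitAddCircle)‖) : s ∈ Icc (1 / 4 : ℝ) (3 / 4) := by
  obtain ⟨h1, h2⟩ := hs
  have h3 := h.trans (UnitAddCircle.norm_coe_le_abs_sub s 0)
  have h4 := h.trans (UnitAddCircle.norm_coe_le_abs_sub s 1)
  rw [Int.cast_zero, sub_zero, abs_of_nonneg h1] at h3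
  rw [Int.cast_one, abs_of_neg (by linarith)] at h4
  exact ⟨h3, by linarith⟩

/-- The preimage of the punctured torus in the plane. -/
def coverRegion : Set (ℝ × ℝ) :=
  {e | 1 / 4 ≤ ‖((e.1 : UnitAddCircle), (e.2 : UnitAddCircle))‖}

theorem mem_coverRegion {e : ℝ × ℝ} :
    e ∈ coverRegion ↔ 1 / 4 ≤ ‖(e.1 : UnitAddCircle)‖ ∨ 1 / 4 ≤ ‖(e.2 : UnitAddCircle)‖ := by
  rw [coverRegion, mem_ofPred_eq, Prod.norm_def, le_max_iff]

theorem sub_intCast_mem_coverRegion {e : ℝ × ℝ} (he : e ∈ coverRegion) (m n : ℤ) :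
    e - ((m : ℝ), (n : ℝ)) ∈ coverRegion := by
  rw [mem_coverRegion] at he ⊢
  simpa only [Prod.fst_sub, Prod.snd_sub, UnitAddCircle.coe_sub_intCast] using he

/-- The projection of a subset of the plane to the punctured torus. -/
def coverProj (S : Set (ℝ × ℝ)) (hS : S ⊆ coverRegion) : C(S, PuncturedTorus) where
  toFun e := ⟨((e.1.1 : UnitAddCircle), (e.1.2 : UnitAddCircle)), hS e.2⟩
  continuous_toFun := by
    refine Continuous.subtype_mk (Continuous.prodMk ?_ ?_) _
    · exact (AddCircle.continuous_mk' 1).comp (continuous_fst.comp continuous_subtype_val)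
    · exact (AddCircle.continuous_mk' 1).comp (continuous_snd.comp continuous_subtype_val)

theorem coverProj_eq {S S' : Set (ℝ × ℝ)} {hS : S ⊆ coverRegion} {hS' : S' ⊆ coverRegion}
    {e : S} {e' : S'} (m n : ℤ) (h : (e' : ℝ × ℝ) = e - ((m : ℝ), (n : ℝ))) :
    coverProj S hS e = coverProj S' hS' e' := by
  refine Subtype.ext (Prod.ext ?_ ?_)
  · change ((e.1.1 : ℝ) : UnitAddCircle) = (e'.1.1 : ℝ)
    rw [h, Prod.fst_sub, UnitAddCircle.coe_sub_intCast]
  · change ((e.1.2 : ℝ) : UnitAddCircle) = (e'.1.2 : ℝ)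
    rw [h, Prod.snd_sub, UnitAddCircle.coe_sub_intCast]

/-- The part of a fundamental square that lies over the punctured torus. -/
def fundamentalRegion : Set (ℝ × ℝ) :=
  {e | e.1 ∈ Ico (0 : ℝ) 1 ∧ e.2 ∈ Ico (0 : ℝ) 1 ∧
    (e.1 ∈ Icc (1 / 4 : ℝ) (3 / 4) ∨ e.2 ∈ Icc (1 / 4 : ℝ) (3 / 4))}

theorem fundamentalRegion_subset : fundamentalRegion ⊆ coverRegion := fun _ he =>
  mem_coverRegion.mpr (he.2.2.imp UnitAddCircle.quarter_le_norm UnitAddCircle.quarter_le_norm)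

theorem mem_fundamentalRegion {e : ℝ × ℝ} (he : e ∈ coverRegion) (h1 : e.1 ∈ Ico (0 : ℝ) 1)
    (h2 : e.2 ∈ Ico (0 : ℝ) 1) : e ∈ fundamentalRegion :=
  ⟨h1, h2, (mem_coverRegion.mp he).imp (UnitAddCircle.mem_Icc_of_quarter_le_norm h1)
    (UnitAddCircle.mem_Icc_of_quarter_le_norm h2)⟩

instance : SimplyConnectedSpace fundamentalRegion := by
  have hstar : StarConvex ℝ ((1 / 2 : ℝ), (1 / 2 : ℝ)) fundamentalRegion := by
    rintro ⟨s, t⟩ ⟨h1, h2, h3⟩ α β hα hβ hαβ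
    have hc : (1 / 2 : ℝ) ∈ Icc (1 / 4 : ℝ) (3 / 4) := by constructor <;> norm_num
    have hc' : (1 / 2 : ℝ) ∈ Ico (0 : ℝ) 1 := by constructor <;> norm_num
    exact ⟨convex_Ico 0 1 hc' h1 hα hβ hαβ, convex_Ico 0 1 hc' h2 hα hβ hαβ,
      h3.imp (fun h => convex_Icc _ _ hc h hα hβ hαβ) (fun h => convex_Icc _ _ hc h hα hβ hαβ)⟩
  have := hstar.contractibleSpace ⟨((1 / 2 : ℝ), (1 / 2 : ℝ)), by
    norm_num [fundamentalRegion]⟩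
  infer_instance

/-- The projection of the fundamental region onto the punctured torus. -/
abbrev fundamentalProj : C(fundamentalRegion, PuncturedTorus) :=
  coverProj fundamentalRegion fundamentalRegion_subset

theorem fundamentalProj_bijective : Function.Bijective fundamentalProj := by
  have : Fact ((0 : ℝ) < 1) := ⟨one_pos⟩
  constructor
  · rintro ⟨⟨s, t⟩, h1, h2, h3⟩ ⟨⟨s', t'⟩, h1', h2', h3'⟩ h
    have h4 := congrArg (fun p : PuncturedTorus => p.1) h
    obtain ⟨h5, h6⟩ := Prod.ext_iff.mp h4
    refine Subtype.ext (Prod.ext ?_ ?_)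
    · exact (AddCircle.coe_eq_coe_iff_of_mem_Ico (a := 0) (by simpa using h1)
        (by simpa using h1')).mp h5
    · exact (AddCircle.coe_eq_coe_iff_of_mem_Ico (a := 0) (by simpa using h2)
        (by simpa using h2')).mp h6
  · rintro ⟨⟨y, z⟩, h⟩
    obtain ⟨s, hs, rfl⟩ := AddCircle.coe_image_Ico_eq (1 : ℝ) 0 ▸ mem_univ y
    obtain ⟨t, ht, rfl⟩ := AddCircle.coe_image_Ico_eq (1 : ℝ) 0 ▸ mem_univ z
    exact ⟨⟨(s, t), mem_fundamentalRegion h (by simpa using hs) (by simpa using ht)⟩, rfl⟩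

theorem Convex.simplyConnectedSpace {S : Set (ℝ × ℝ)} (hS : Convex ℝ S) (hne : S.Nonempty) :
    SimplyConnectedSpace S :=
  have := hS.contractibleSpace hne
  inferInstance

/-- The path class of a short piece of a path is computed in any piece of the plane that contains a
translate of a lift of it. -/
theorem transportAlong_eq_of_lift (S : Set (ℝ × ℝ)) (hS : S ⊆ coverRegion) [SimplyConnectedSpace S]
    (γ : C(unitInterval, PuncturedTorus)) (l : C(unitInterval, ℝ × ℝ))
    (hl : ∀ t, (γ t).1 = (((l t).1 : UnitAddCircle), ((l t).2 : UnitAddCircle))) (m n : ℤ)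
    {t₀ : unitInterval} {ε : ℝ}
    (hball : ∀ t, dist t t₀ < ε → l t - ((m : ℝ), (n : ℝ)) ∈ S) {t t' : unitInterval}
    (ht : dist t t₀ < ε) (ht' : dist t' t₀ < ε) :
    ∃ (h : coverProj S hS ⟨_, hball t ht⟩ = γ t) (h' : coverProj S hS ⟨_, hball t' ht'⟩ = γ t'),
      transportAlong γ t t' rfl rfl = transportAlong (coverProj S hS) _ _ h h' := by
  let J : Set ℝ := Icc 0 1 ∩ Metric.ball (t₀ : ℝ) ε
  have hJ : ContractibleSpace J :=
    ((convex_Icc (0 : ℝ) 1).inter (convex_ball _ _)).contractibleSpace ⟨t, t.2, ht⟩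
  let g : C(J, unitInterval) := ⟨fun r => ⟨r.1, r.2.1⟩, by fun_prop⟩
  let g' : C(J, S) := ⟨fun r => ⟨l (g r) - ((m : ℝ), (n : ℝ)), hball _ r.2.2⟩, by fun_prop⟩
  have hgg : ∀ r, γ (g r) = coverProj S hS (g' r) := fun r => by
    refine Subtype.ext ((hl (g r)).trans (Prod.ext ?_ ?_))
    · exact (UnitAddCircle.coe_sub_intCast _ m).symm
    · exact (UnitAddCircle.coe_sub_intCast _ n).symm
  have := transportAlong_eq_of_comp_eq γ (coverProj S hS) g g' hgg (u := ⟨t, t.2, ht⟩)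
    (v := ⟨t', t'.2, ht'⟩) rfl rfl
  exact ⟨_, _, this⟩

/-- The strip of the cover around a vertical edge of the fundamental square. -/
def verticalStrip : Set (ℝ × ℝ) := Ioo (-1 / 4 : ℝ) (1 / 4) ×ˢ Icc (1 / 4 : ℝ) (3 / 4)

/-- The strip of the cover around a horizontal edge of the fundamental square. -/
def horizontalStrip : Set (ℝ × ℝ) := Icc (1 / 4 : ℝ) (3 / 4) ×ˢ Ioo (-1 / 4 : ℝ) (1 / 4)

theorem verticalStrip_subset : verticalStrip ⊆ coverRegion := fun _ he =>
  mem_coverRegion.mpr (Or.inr (UnitAddCircle.quarter_le_norm he.2))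

theorem horizontalStrip_subset : horizontalStrip ⊆ coverRegion := fun _ he =>
  mem_coverRegion.mpr (Or.inl (UnitAddCircle.quarter_le_norm he.1))

instance : SimplyConnectedSpace verticalStrip :=
  ((convex_Ioo _ _).prod (convex_Icc _ _)).simplyConnectedSpace
    ⟨(0, 1 / 2), by norm_num [verticalStrip]⟩

instance : SimplyConnectedSpace horizontalStrip :=
  ((convex_Icc _ _).prod (convex_Ioo _ _)).simplyConnectedSpace
    ⟨(1 / 2, 0), by norm_num [horizontalStrip]⟩

/-- The paths in a strip, closed up by paths in the fundamental region, lie in one cyclic subgroup of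
the fundamental group. -/
theorem exists_zpowers_strip {x : PuncturedTorus} (x' : fundamentalRegion)
    (hx : fundamentalProj x' = x) (q : ∀ y, FundamentalGroupoid.mk x ⟶ FundamentalGroupoid.mk y)
    (hq : ∀ (k : fundamentalRegion) y (h : fundamentalProj k = y),
      q y = transportAlong fundamentalProj x' k hx h)
    (S : Set (ℝ × ℝ)) (hS : S ⊆ coverRegion) [SimplyConnectedSpace S]
    (P N : Set (ℝ × ℝ)) (hP : Convex ℝ P) (hN : Convex ℝ N) (hP0 : P.Nonempty) (hN0 : N.Nonempty)
    (hSPN : S = P ∪ N) (hPQ : P ⊆ fundamentalRegion) (m n : ℤ)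
    (hNQ : ∀ e ∈ N, e - ((m : ℝ), (n : ℝ)) ∈ fundamentalRegion) :
    ∃ a : FundamentalGroup PuncturedTorus x, ∀ s s' y y' (hs : coverProj S hS s = y)
      (hs' : coverProj S hS s' = y'),
      (q y ≫ transportAlong (coverProj S hS) s s' hs hs' ≫ inv (q y') :
        FundamentalGroup PuncturedTorus x) ∈ Subgroup.zpowers a := by
  have := hP.simplyConnectedSpace hP0
  have := hN.simplyConnectedSpace hN0
  refine exists_zpowers_of_two_pieces fundamentalProj (coverProj S hS) x' hx q hq
    ⟨fun p : P => ⟨p, hSPN ▸ Or.inl p.2⟩, by fun_prop⟩ ⟨fun p : P => ⟨p, hPQ p.2⟩, by fun_prop⟩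
    (fun p => rfl)
    ⟨fun p : N => ⟨p, hSPN ▸ Or.inr p.2⟩, by fun_prop⟩ ⟨fun p : N => ⟨_, hNQ p p.2⟩, by fun_prop⟩
    (fun p => coverProj_eq m n rfl) ?_
  rintro ⟨s, hs⟩
  rcases hSPN ▸ hs with h | h
  · exact Or.inl ⟨⟨s, h⟩, rfl⟩
  · exact Or.inr ⟨⟨s, h⟩, rfl⟩

/-- The fundamental group of the punctured torus is generated by two elements. -/
theorem PuncturedTorus.exists_closure_pair_eq_top (x : PuncturedTorus) :
    ∃ a b : FundamentalGroup PuncturedTorus x, Subgroup.closure {a, b} = ⊤ := by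
  have : Fact ((0 : ℝ) < 1) := ⟨one_pos⟩
  choose r hr using fundamentalProj_bijective.2
  let q : ∀ y, FundamentalGroupoid.mk x ⟶ FundamentalGroupoid.mk y := fun y =>
    transportAlong fundamentalProj (r x) (r y) (hr x) (hr y)
  have hq : ∀ (k : fundamentalRegion) y (h : fundamentalProj k = y),
      q y = transportAlong fundamentalProj (r x) k (hr x) h := by
    intro k y h
    obtain rfl : r y = k := fundamentalProj_bijective.1 ((hr y).trans h.symm)
    rfl
  obtain ⟨a, ha⟩ := exists_zpowers_strip (r x) (hr x) q hq verticalStrip verticalStrip_subset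
    (Ico (0 : ℝ) (1 / 4) ×ˢ Icc (1 / 4 : ℝ) (3 / 4)) (Ioo (-1 / 4 : ℝ) 0 ×ˢ Icc (1 / 4 : ℝ) (3 / 4))
    ((convex_Ico _ _).prod (convex_Icc _ _)) ((convex_Ioo _ _).prod (convex_Icc _ _))
    ⟨(0, 1 / 2), by norm_num⟩ ⟨(-1 / 8, 1 / 2), by norm_num⟩
    (by
      rw [← union_prod, verticalStrip, union_comm, Ioo_union_Ico_eq_Ioo (by norm_num) (by norm_num)])
    (fun e he => ⟨⟨he.1.1, by linarith [he.1.2]⟩, ⟨by linarith [he.2.1], by linarith [he.2.2]⟩,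
      Or.inr he.2⟩) (-1) 0
    (fun e he => by
      obtain ⟨⟨h1, h2⟩, ⟨h3, h4⟩⟩ := he
      refine ⟨⟨?_, ?_⟩, ⟨?_, ?_⟩, Or.inr ⟨?_, ?_⟩⟩ <;> simp <;> linarith)
  obtain ⟨b, hb⟩ := exists_zpowers_strip (r x) (hr x) q hq horizontalStrip horizontalStrip_subset
    (Icc (1 / 4 : ℝ) (3 / 4) ×ˢ Ico (0 : ℝ) (1 / 4)) (Icc (1 / 4 : ℝ) (3 / 4) ×ˢ Ioo (-1 / 4 : ℝ) 0)
    ((convex_Icc _ _).prod (convex_Ico _ _)) ((convex_Icc _ _).prod (convex_Ioo _ _))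
    ⟨(1 / 2, 0), by norm_num⟩ ⟨(1 / 2, -1 / 8), by norm_num⟩
    (by
      rw [← prod_union, horizontalStrip, union_comm,
        Ioo_union_Ico_eq_Ioo (by norm_num) (by norm_num)])
    (fun e he => ⟨⟨by linarith [he.1.1], by linarith [he.1.2]⟩, ⟨he.2.1, by linarith [he.2.2]⟩,
      Or.inl he.1⟩) 0 (-1)
    (fun e he => by
      obtain ⟨⟨h1, h2⟩, ⟨h3, h4⟩⟩ := he
      refine ⟨⟨?_, ?_⟩, ⟨?_, ?_⟩, Or.inl ⟨?_, ?_⟩⟩ <;> simp <;> linarith)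
  have haH : Subgroup.zpowers a ≤ Subgroup.closure {a, b} := by
    rw [Subgroup.zpowers_le]; exact Subgroup.subset_closure (by simp)
  have hbH : Subgroup.zpowers b ≤ Subgroup.closure {a, b} := by
    rw [Subgroup.zpowers_le]; exact Subgroup.subset_closure (by simp)
  refine ⟨a, b, (Subgroup.eq_top_iff' _).mpr fun p => ?_⟩
  obtain ⟨γ, rfl⟩ := Path.Homotopic.Quotient.mk_surjective p
  refine mem_subgroup_of_locally _ q (transportAlong_self _ _ _) γ fun t₀ => ?_
  obtain ⟨l₁, hl₁, -⟩ := (AddCircle.isCoveringMap_coe (1 : ℝ)).exists_path_lifts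
    ⟨fun t => (γ t).1.1, by fun_prop⟩ (r x).1.1
    (by change (γ 0).1.1 = _; rw [γ.source]; exact congrArg (fun y => y.1.1) (hr x).symm)
  obtain ⟨l₂, hl₂, -⟩ := (AddCircle.isCoveringMap_coe (1 : ℝ)).exists_path_lifts
    ⟨fun t => (γ t).1.2, by fun_prop⟩ (r x).1.2
    (by change (γ 0).1.2 = _; rw [γ.source]; exact congrArg (fun y => y.1.2) (hr x).symm)
  let l : C(unitInterval, ℝ × ℝ) := ⟨fun t => (l₁ t, l₂ t), by fun_prop⟩
  have hl : ∀ t, (γ.toContinuousMap t).1 =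
      (((l t).1 : UnitAddCircle), ((l t).2 : UnitAddCircle)) := fun t =>
    Prod.ext (congrFun hl₁ t).symm (congrFun hl₂ t).symm
  have hlE : ∀ t, l t ∈ coverRegion := fun t => by
    change 1 / 4 ≤ ‖(((l t).1 : UnitAddCircle), ((l t).2 : UnitAddCircle))‖
    rw [← hl t]; exact (γ t).2
  let m := ⌊(l t₀).1⌋
  let n := ⌊(l t₀).2⌋
  let d : unitInterval → ℝ × ℝ := fun t => l t - ((m : ℝ), (n : ℝ))
  have hdE : ∀ t, d t ∈ coverRegion := fun t => sub_intCast_mem_coverRegion (hlE t) m n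
  have hd₁ : Continuous fun t => (d t).1 := by fun_prop
  have hd₂ : Continuous fun t => (d t).2 := by fun_prop
  have hd₁0 : (d t₀).1 ∈ Ico (0 : ℝ) 1 := ⟨Int.fract_nonneg _, Int.fract_lt_one _⟩
  have hd₂0 : (d t₀).2 ∈ Ico (0 : ℝ) 1 := ⟨Int.fract_nonneg _, Int.fract_lt_one _⟩
  have hd0 : d t₀ ∈ fundamentalRegion := mem_fundamentalRegion (hdE t₀) hd₁0 hd₂0
  have main : ∀ S : Set (ℝ × ℝ), ∀ hS : S ⊆ coverRegion, ∀ _ : SimplyConnectedSpace S,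
      (∀ᶠ t in nhds t₀, d t ∈ S) →
      (∀ s s' y y' (hs : coverProj S hS s = y) (hs' : coverProj S hS s' = y'),
        (q y ≫ transportAlong (coverProj S hS) s s' hs hs' ≫ inv (q y') :
        FundamentalGroup PuncturedTorus x) ∈ Subgroup.closure {a, b}) →
      ∃ J ∈ nhds t₀, ∀ t ∈ J, ∀ t' ∈ J,
        (q (γ t) ≫ transportAlong γ.toContinuousMap t t' rfl rfl ≫ inv (q (γ t')) :
          FundamentalGroup PuncturedTorus x) ∈ Subgroup.closure {a, b} := by
    intro S hS _ hev hmem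
    obtain ⟨ε, hε, hball⟩ := Metric.eventually_nhds_iff.mp hev
    refine ⟨Metric.ball t₀ ε, Metric.ball_mem_nhds _ hε, fun t ht t' ht' => ?_⟩
    obtain ⟨h, h', heq⟩ := transportAlong_eq_of_lift S hS γ.toContinuousMap l hl m n
      (fun t ht => hball ht) ht ht'
    rw [heq]
    exact hmem _ _ _ _ h h'
  have hIoo : ∀ {u : ℝ}, u ∈ Icc (1 / 4 : ℝ) (3 / 4) → u ∈ Ioo (0 : ℝ) 1 := fun hu =>
    ⟨by linarith [hu.1], by linarith [hu.2]⟩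
  have hnot : ∀ {u : ℝ}, u ∈ Ioo (-1 / 4 : ℝ) (1 / 4) → ¬ 1 / 4 ≤ ‖(u : UnitAddCircle)‖ :=
    fun {u} hu h => by
      have h3 := h.trans (UnitAddCircle.norm_coe_le_abs_sub u 0)
      rw [Int.cast_zero, sub_zero] at h3
      exact absurd h3 (not_le.mpr (abs_lt.mpr ⟨by linarith [hu.1], hu.2⟩))
  by_cases h1 : (d t₀).1 = 0
  · have h2 : (d t₀).2 ∈ Icc (1 / 4 : ℝ) (3 / 4) := hd0.2.2.resolve_left fun h => by
      rw [h1] at h; linarith [h.1]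
    refine main verticalStrip verticalStrip_subset inferInstance ?_ fun s s' y y' hs hs' =>
      haH (ha s s' y y' hs hs')
    filter_upwards [hd₁.continuousAt.eventually (Ioo_mem_nhds (a := -1 / 4) (b := 1 / 4)
        (by beta_reduce; rw [h1]; norm_num)
        (by beta_reduce; rw [h1]; norm_num)),
      hd₂.continuousAt.eventually (isOpen_Ioo.mem_nhds (hIoo h2))] with t ht₁ ht₂
    exact ⟨ht₁, UnitAddCircle.mem_Icc_of_quarter_le_norm (Ioo_subset_Ico_self ht₂)
      ((mem_coverRegion.mp (hdE t)).resolve_left (hnot ht₁))⟩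
  by_cases h2 : (d t₀).2 = 0
  · have h3 : (d t₀).1 ∈ Icc (1 / 4 : ℝ) (3 / 4) := hd0.2.2.resolve_right fun h => by
      rw [h2] at h; linarith [h.1]
    refine main horizontalStrip horizontalStrip_subset inferInstance ?_ fun s s' y y' hs hs' =>
      hbH (hb s s' y y' hs hs')
    filter_upwards [hd₂.continuousAt.eventually (Ioo_mem_nhds (a := -1 / 4) (b := 1 / 4)
        (by beta_reduce; rw [h2]; norm_num)
        (by beta_reduce; rw [h2]; norm_num)),
      hd₁.continuousAt.eventually (isOpen_Ioo.mem_nhds (hIoo h3))] with t ht₂ ht₁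
    exact ⟨UnitAddCircle.mem_Icc_of_quarter_le_norm (Ioo_subset_Ico_self ht₁)
      ((mem_coverRegion.mp (hdE t)).resolve_right (hnot ht₂)), ht₂⟩
  · refine main fundamentalRegion fundamentalRegion_subset inferInstance ?_
      fun s s' y y' hs hs' => ?_
    · filter_upwards [hd₁.continuousAt.eventually
          (Ioo_mem_nhds (lt_of_le_of_ne hd₁0.1 (Ne.symm h1)) hd₁0.2),
        hd₂.continuousAt.eventually
          (Ioo_mem_nhds (lt_of_le_of_ne hd₂0.1 (Ne.symm h2)) hd₂0.2)] with t ht₁ ht₂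
      exact mem_fundamentalRegion (hdE t) (Ioo_subset_Ico_self ht₁) (Ioo_subset_Ico_self ht₂)
    · rw [hq s y hs, hq s' y' hs', inv_transportAlong, transportAlong_comp, transportAlong_comp,
        transportAlong_self]
      exact one_mem _

end PuncturedTorus

/-- Flowing once around the base circle is a homotopy from the inclusion of the fibre to its
composite with the monodromy. -/
def fibreHomotopy (h : PuncturedTorus ≃ₜ PuncturedTorus) :
    (fibreInclusion h).Homotopy ((fibreInclusion h).comp (h : C(PuncturedTorus, PuncturedTorus)))
    where
  toFun z := Quot.mk _ (z.2, z.1)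
  continuous_toFun := continuous_quot_mk.comp (by fun_prop)
  map_zero_left _ := rfl
  map_one_left _ := Quot.sound ⟨rfl, rfl⟩

theorem map_comp_eqToHom {X Y : Type*} [TopologicalSpace X] [TopologicalSpace Y] (f : C(X, Y))
    {x : X} {y : Y} (h : f x = y) (g : FundamentalGroup X x) :
    (FundamentalGroup.map f x g).toArrow ≫ eqToHom (congrArg FundamentalGroupoid.mk h) =
      eqToHom (congrArg FundamentalGroupoid.mk h) ≫ (FundamentalGroup.mapOfEq f h g).toArrow := by
  subst h
  rw [FundamentalGroup.mapOfEq_apply, Path.Homotopic.Quotient.cast_rfl_rfl, eqToHom_refl,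
    Category.comp_id, Category.id_comp]
  rfl

theorem comp_comp_eq_of_square {𝒞 : Type*} [Category* 𝒞] {A B : 𝒞} {u w : A ⟶ A} {v : B ⟶ B}
    {n : A ⟶ B} {c : B ⟶ A} (h₁ : u ≫ n = n ≫ v) (h₂ : v ≫ c = c ≫ w) :
    u ≫ n ≫ c = (n ≫ c) ≫ w := by
  rw [← Category.assoc, h₁, Category.assoc, h₂, Category.assoc]

/-- Some element of the fundamental group of the bundle acts on that of the fibre by the
monodromy. -/
theorem exists_conj_eq_monodromy (h : PuncturedTorus ≃ₜ PuncturedTorus) {x : PuncturedTorus}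
    (hx : h x = x) :
    ∃ t : FundamentalGroup (PuncturedTorusBundle h) (fibreInclusion h x), ∀ g,
      t * FundamentalGroup.map (fibreInclusion h) x g * t⁻¹ =
        FundamentalGroup.map (fibreInclusion h) x
          (FundamentalGroup.mapOfEq (h : C(PuncturedTorus, PuncturedTorus)) hx g) := by
  let ι := fibreInclusion h
  let η := FundamentalGroupoidFunctor.homotopicMapsNatIso (fibreHomotopy h)
  let θ := FundamentalGroup.mapOfEq (h : C(PuncturedTorus, PuncturedTorus)) hx
  let c : FundamentalGroupoid.mk (ι (h x)) ⟶ FundamentalGroupoid.mk (ι x) :=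
    (FundamentalGroupoid.map ι).map (eqToHom (congrArg FundamentalGroupoid.mk hx))
  let t : FundamentalGroup (PuncturedTorusBundle h) (ι x) := η.app (FundamentalGroupoid.mk x) ≫ c
  refine ⟨t, fun g => ?_⟩
  rw [mul_inv_eq_iff_eq_mul]
  have hnat : (FundamentalGroupoid.map ι).map g ≫ η.app (FundamentalGroupoid.mk x) =
      η.app (FundamentalGroupoid.mk x) ≫ (FundamentalGroupoid.map ι).map
        ((FundamentalGroupoid.map (h : C(PuncturedTorus, PuncturedTorus))).map g) := by
    refine (η.naturality g).trans ?_
    congr 1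
    exact Path.Homotopic.Quotient.map_comp (p := g)
  have hc := congrArg (FundamentalGroupoid.map ι).map
    (map_comp_eqToHom (h : C(PuncturedTorus, PuncturedTorus)) hx g)
  exact comp_comp_eq_of_square hnat (((FundamentalGroupoid.map ι).map_comp _ _).symm.trans
    (hc.trans ((FundamentalGroupoid.map ι).map_comp _ _)))

theorem mapOfEq_surjective (h : PuncturedTorus ≃ₜ PuncturedTorus) {x : PuncturedTorus}
    (hx : h x = x) : Function.Surjective
      (FundamentalGroup.mapOfEq (h : C(PuncturedTorus, PuncturedTorus)) hx) := by
  intro g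
  have hx' : h.symm x = x := (h.symm_apply_eq).mpr hx.symm
  refine ⟨FundamentalGroup.mapOfEq (h.symm : C(PuncturedTorus, PuncturedTorus)) hx' g, ?_⟩
  rw [FundamentalGroup.mapOfEq_apply, FundamentalGroup.mapOfEq_apply]
  obtain ⟨γ, rfl⟩ := Path.Homotopic.Quotient.mk_surjective g
  change Path.Homotopic.Quotient.mk _ = _
  congr 1
  refine Path.ext (funext fun t => ?_)
  exact h.apply_symm_apply (γ t)

theorem theorem1p3
    (h : PuncturedTorus ≃ₜ PuncturedTorus)
    (hfix : ∀ p ∈ PuncturedTorus.boundary, h p = p)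
    (x : PuncturedTorus) (hx : x ∈ PuncturedTorus.boundary)
    (hyp : IsHyperbolicMonodromy h (hfix x hx))
    (lt : FundamentalGroup (PuncturedTorusBundle h) (fibreInclusion h x) →
      FundamentalGroup (PuncturedTorusBundle h) (fibreInclusion h x) → Prop)
    (hlt : IsBiOrder lt)
    (C : Subgroup ↥⁅fibreGroup h x, fibreGroup h x⁆)
    (hC : IsMaximalConvexSubgroup (inducedOrder lt ⁅fibreGroup h x, fibreGroup h x⁆) C) :
    C.map (Subgroup.subtype ⁅fibreGroup h x, fibreGroup h x⁆) =
      ⁅⁅fibreGroup h x, fibreGroup h x⁆, fibreGroup h x⁆ := by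
  obtain ⟨t, ht⟩ := exists_conj_eq_monodromy h (hfix x hx)
  obtain ⟨a, b, hab⟩ := PuncturedTorus.exists_closure_pair_eq_top x
  have hsurj := mapOfEq_surjective h (hfix x hx)
  have hspan : Submodule.span ℤ {(Additive.ofMul (Abelianization.of a) : PuncturedTorus.H1 x),
      Additive.ofMul (Abelianization.of b)} = ⊤ := by
    rw [eq_top_iff]
    intro v _
    obtain ⟨g, hg⟩ := QuotientGroup.mk_surjective v.toMul
    obtain rfl : Additive.ofMul (Abelianization.of g) = v := hg
    have hg : g ∈ Subgroup.closure {a, b} := hab ▸ Subgroup.mem_top g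
    induction hg using Subgroup.closure_induction with
    | mem y hy =>
      apply Submodule.subset_span
      rcases hy with rfl | rfl <;> simp
    | one => exact zero_mem _
    | mul y z _ _ hy hz => exact add_mem (hy trivial) (hz trivial)
    | inv y _ hy => exact neg_mem (hy trivial)
  refine IsMaximalConvexSubgroup.map_subtype_eq_commutator hlt
    (FundamentalGroup.map (fibreInclusion h) x) _ hsurj t ht hab (fun L hL => ?_) rfl hC
  have hψ := eq_zero_of_two_lt_abs_trace hspan (homologyMap h (hfix x hx)) ?_ hyp
    (MonoidHom.toAdditiveLeft (Abelianization.lift L)) ?_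
  · ext g
    exact DFunLike.congr_fun hψ (Additive.ofMul (Abelianization.of g))
  · intro v
    obtain ⟨g, hg⟩ := QuotientGroup.mk_surjective v.toMul
    obtain ⟨k, rfl⟩ := hsurj g
    exact ⟨Additive.ofMul (Abelianization.of k), hg⟩
  · intro v
    obtain ⟨g, hg⟩ := QuotientGroup.mk_surjective v.toMul
    obtain rfl : Additive.ofMul (Abelianization.of g) = v := hg
    exact hL g
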